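/- For integers $k_1,\dots,k_{n-1}\ge 1$ and $k_n\ge 2$ put $$\zeta_-(k_1,\dots,k_n):=\sum_{0<m_1<\cdots<m_n<\infty}\frac{(-1)^{m_n-1}}{m_1^{k_1}\cdots m_n^{k_n}},$$ an absolutely convergent series, and write $\{1\}^{a}$ for $a$ successive entries equal to $1$ (no entry if $a=0$). Binomial coefficients are $\binom{n}{k}=\frac{n(n-1)\cdots(n-k+1)}{k!}$ for $n\in\mathbb{Z}$ and $k\in\mathbb{Z}_{\ge 0}$ (so $\binom{-1}{0}=1$), and $\binom{n}{-1}=0$. Let $r\ge 0$ and $s\ge 1$ be integers. Then each of the two sums $$\sum_{i=0}^{r}(-1)^{r-i}\left\{\binom{s-2+i}{i}+\binom{s-1+i}{i}\right\}\zeta_-(\{1\}^{r-i},2s+i),$$ $$\sum_{i=0}^{r}(-1)^{r-i}\,2^{r-i+1}\left\{\binom{2s+i-1}{i}-\binom{2s+i-1}{i-1}\right\}\zeta_-(\{1\}^{r-i},2s+i)$$ is the value of a polynomial with rational coefficients in the Riemann zeta values $\zeta(k)=\sum_{m=1}^{\infty}m^{-k}$, $k\in\mathbb{Z}_{\ge 2}$.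 -/

import Mathlib

/-- The strictly increasing tuples `0 < m₁ < ⋯ < mₙ₊₁` of integers. -/
abbrev IncTuple (n : ℕ) : Type := {m : Fin (n + 1) → ℕ // (∀ j, 0 < m j) ∧ StrictMono m}

/-- The term `z ^ (mₙ₊₁ - 1) / (m₁ ^ k₁ ⋯ mₙ₊₁ ^ kₙ₊₁)` of a multiple polylogarithm value. -/
noncomputable def mplTerm (z : ℂ) {n : ℕ} (k : Fin (n + 1) → ℕ) (m : IncTuple n) : ℂ :=
  z ^ (m.1 (Fin.last n) - 1) / ∏ j, (m.1 j : ℂ) ^ k j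

/-- The multiple polylogarithm value of depth `n + 1` with exponents `k`,
`∑_{0 < m₁ < ⋯ < mₙ₊₁} z ^ (mₙ₊₁ - 1) / (m₁ ^ k₁ ⋯ mₙ₊₁ ^ kₙ₊₁)`. -/
noncomputable def mplValue (z : ℂ) {n : ℕ} (k : Fin (n + 1) → ℕ) : ℂ :=
  ∑' m : IncTuple n, mplTerm z k m

/-- The alternating value `ζ₋(k₁, …, kₙ₊₁)`. -/
noncomputable def zetaMinus {n : ℕ} (k : Fin (n + 1) → ℕ) : ℂ := mplValue (-1) k

/-- The index `({1}^a, b)`, of depth `a + 1`. -/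
def onesThen (a b : ℕ) : Fin (a + 1) → ℕ := Fin.snoc (α := fun _ => ℕ) (fun _ : Fin a => 1) b

/-- The binomial coefficient of integers `n (n - 1) ⋯ (n - k + 1) / k!`, which is `1` for `k = 0`
and every `n`, and `0` for `k < 0`. -/
def intBinom (n k : ℤ) : ℤ := if 0 ≤ k then Ring.choose n k.toNat else 0

/-- `x` is the value of a polynomial with rational coefficients at finitely many of the Riemann
zeta values `ζ(2), ζ(3), ζ(4), …`. -/
def IsRatPolyInZetaValues (x : ℂ) : Prop :=
  ∃ P : MvPolynomial {k : ℕ // 2 ≤ k} ℚ,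
    x = MvPolynomial.aeval (fun k : {k : ℕ // 2 ≤ k} => riemannZeta (k.1 : ℂ)) P

/-!
Consider the `Y ^ s`-coefficient of `∏ₙ (1 - zₙ⁻¹ Y)⁻¹`, where `zₙ = (n + 1) (n + 1 - X)` is a
unit of `ℂ⟦X⟧`. The power sums of the `zₙ⁻¹` have coefficients in the algebra generated by the
zeta values, hence so does this coefficient, by Newton's identities. On the other hand, partial
fractions in `Y` turn it into `∑ₘ wₘ zₘ⁻ˢ` with
`wₘ = (-1) ^ m (2 - X / (m + 1)) ∏_{j < m} (1 - X / (j + 1))`, by dominated convergence from the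
finite products, and the `X ^ r`-coefficient of `∑ₘ wₘ zₘ⁻ˢ` is the first sum.

Up to a power of `2`, the first sum pairs the values `(-2) ^ (r - l) ζ₋({1}ʳ⁻ˡ, 2s + l)` with the
coefficients of `2 (1 - X) (1 - 2X)⁻ˢ`, and the second one pairs them with those of
`2 (1 - 2X) (1 - X) ^ (-2s - 1)`. Trading factors `(1 - 2X)⁻¹` for `(1 - X)⁻²` by means of
`(1 - X) ^ 2 - X ^ 2 = 1 - 2X` leads from one to the other; the factors `X ^ 2` arising on the way
lower `r` by `2` and raise `s` by `1`.
-/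

open PowerSeries

section GeometricSeries

variable {R : Type*} [CommRing R]

/-- The geometric series `(1 - a X)⁻¹`, over a ring in which power series need have no `⁻¹`. -/
def geomSeries (a : R) : R⟦X⟧ := PowerSeries.mk fun n => a ^ n

@[simp]
theorem coeff_geomSeries (a : R) (n : ℕ) : coeff n (geomSeries a) = a ^ n :=
  coeff_mk n _

@[simp]
theorem constantCoeff_geomSeries (a : R) : constantCoeff (geomSeries a) = 1 := by
  simp [← coeff_zero_eq_constantCoeff_apply]

theorem rescale_mk_one (a : R) : rescale a (PowerSeries.mk 1) = geomSeries a := by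
  ext n
  simp

theorem rescale_geomSeries (a b : R) : rescale b (geomSeries a) = geomSeries (b * a) := by
  ext n
  simp [mul_pow]

theorem one_sub_C_mul_X_mul_geomSeries (a : R) : (1 - C a * X) * geomSeries a = 1 := by
  have h := congrArg (rescale a) (mk_one_mul_one_sub_eq_one R)
  simpa [rescale_mk_one, rescale_X, mul_comm] using h

theorem one_sub_X_mul_geomSeries_one : (1 - X) * geomSeries (1 : R) = 1 := by
  simpa using one_sub_C_mul_X_mul_geomSeries (1 : R)

theorem coeff_geomSeries_pow (a : R) (s i : ℕ) :
    coeff i (geomSeries a ^ s) = ((intBinom (s - 1 + i) i : ℤ) : R) * a ^ i := by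
  rw [← rescale_mk_one, ← map_pow, coeff_rescale, mul_comm, intBinom, if_pos i.cast_nonneg,
    Int.toNat_natCast]
  congr 1
  rcases s with _ | s
  · rcases i with _ | i
    · simp
    · have h : ((0 : ℕ) : ℤ) - 1 + (i + 1 : ℕ) = i := by push_cast; ring
      rw [h, Ring.choose_natCast]
      simp [coeff_one]
  · have h : ((s + 1 : ℕ) : ℤ) - 1 + i = (s + i : ℕ) := by push_cast; ring
    rw [h, Ring.choose_natCast, mk_one_pow_eq_mk_choose_add, coeff_mk, Nat.choose_symm_add]
    simp

theorem X_mul_derivative_geomSeries (a : R) :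
    X * derivative R (geomSeries a) = geomSeries a * (X * C a * geomSeries a) := by
  have h : derivative R ((1 - C a * X) * geomSeries a) = 0 := by
    rw [one_sub_C_mul_X_mul_geomSeries, Derivation.map_one_eq_zero]
  have hl : derivative R (1 - C a * X) = -C a := by simp [Derivation.leibniz]
  rw [Derivation.leibniz, hl, smul_eq_mul, smul_eq_mul] at h
  linear_combination (X * geomSeries a) * h -
    (X * derivative R (geomSeries a)) * one_sub_C_mul_X_mul_geomSeries a

end GeometricSeries

section CompleteHomogeneous

variable {R ι : Type*} [CommRing R]

/-- The generating function `∏ (1 - xₙ X)⁻¹` of the complete homogeneous symmetric functions of the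
`xₙ`, `n ∈ S`: its coefficient of `X ^ s` is `hₛ`. -/
noncomputable def hsymmSeries (S : Finset ι) (x : ι → R) : R⟦X⟧ := ∏ n ∈ S, geomSeries (x n)

theorem X_mul_derivative_hsymmSeries (S : Finset ι) (x : ι → R) :
    X * derivative R (hsymmSeries S x) =
      hsymmSeries S x * ∑ n ∈ S, X * C (x n) * geomSeries (x n) := by
  classical
  simp only [hsymmSeries]
  induction S using Finset.induction_on with
  | empty => simp
  | insert n S hn ih =>
    rw [Finset.prod_insert hn, Finset.sum_insert hn, Derivation.leibniz, smul_eq_mul, smul_eq_mul]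
    linear_combination geomSeries (x n) * ih +
      (∏ n ∈ S, geomSeries (x n)) * X_mul_derivative_geomSeries (x n)

theorem sum_X_mul_C_mul_geomSeries (S : Finset ι) (x : ι → R) :
    ∑ n ∈ S, X * C (x n) * geomSeries (x n) =
      X * PowerSeries.mk fun k => ∑ n ∈ S, x n ^ (k + 1) := by
  simp_rw [mul_assoc, ← Finset.mul_sum]
  congr 1
  ext k
  simp [pow_succ']

theorem succ_mul_coeff_hsymmSeries (S : Finset ι) (x : ι → R) (s : ℕ) :
    ((s + 1 : ℕ) : R) * coeff (s + 1) (hsymmSeries S x) =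
      ∑ k ∈ Finset.range (s + 1), (∑ n ∈ S, x n ^ (k + 1)) * coeff (s - k) (hsymmSeries S x) := by
  have h := congrArg (coeff (s + 1)) (X_mul_derivative_hsymmSeries S x)
  rw [sum_X_mul_C_mul_geomSeries, mul_left_comm, coeff_succ_X_mul, coeff_succ_X_mul,
    coeff_derivative, mul_comm (hsymmSeries S x), coeff_mul,
    Finset.Nat.sum_antidiagonal_eq_sum_range_succ_mk] at h
  push_cast
  rw [mul_comm]
  simpa using h

open Filter Topology in
theorem exists_tendsto_coeff_hsymmSeries [Algebra ℚ R] [TopologicalSpace R] [IsTopologicalRing R]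
    (A : Subalgebra ℚ R) {κ : Type*} {l : Filter κ} {S : κ → Finset ι} {x : ι → R}
    (h : ∀ k, ∃ p ∈ A, Tendsto (fun N => ∑ n ∈ S N, x n ^ (k + 1)) l (𝓝 p)) (s : ℕ) :
    ∃ y ∈ A, Tendsto (fun N => coeff s (hsymmSeries (S N) x)) l (𝓝 y) := by
  choose p hpA hp using h
  induction s using Nat.strong_induction_on with
  | _ s ih =>
    rcases s with _ | s
    · exact ⟨1, A.one_mem, by simp [hsymmSeries, map_prod, tendsto_const_nhds]⟩
    · choose! y hyA hy using ih
      have hlt (k : ℕ) : s - k < s + 1 := by omega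
      refine ⟨((s + 1 : ℕ) : ℚ)⁻¹ • ∑ k ∈ Finset.range (s + 1), p k * y (s - k),
        A.smul_mem (A.sum_mem fun k _ => A.mul_mem (hpA k) (hyA _ (hlt k))) _, ?_⟩
      have hsolve (N : κ) : coeff (s + 1) (hsymmSeries (S N) x) = ((s + 1 : ℕ) : ℚ)⁻¹ •
          ∑ k ∈ Finset.range (s + 1),
            (∑ n ∈ S N, x n ^ (k + 1)) * coeff (s - k) (hsymmSeries (S N) x) := by
        rw [← succ_mul_coeff_hsymmSeries, ← nsmul_eq_mul, ← Nat.cast_smul_eq_nsmul ℚ, smul_smul,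
          inv_mul_cancel₀ (by positivity), one_smul]
      simp_rw [hsolve, Algebra.smul_def]
      exact (tendsto_finsetSum _ fun k _ => (hp k).mul (hy _ (hlt k))).const_mul _

end CompleteHomogeneous

section ElementarySymmetric

variable {R ι : Type*} [CommRing R]

/-- The generating function `∏ (1 - xₙ X)` of the elementary symmetric functions of the `xₙ`,
`n ∈ S`: its coefficient of `X ^ a` is `(-1) ^ a eₐ`. -/
noncomputable def esymmSeries (S : Finset ι) (x : ι → R) : R⟦X⟧ :=
  ∏ n ∈ S, (1 - C (x n) * X)

theorem coeff_esymmSeries (S : Finset ι) (x : ι → R) (a : ℕ) :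
    coeff a (esymmSeries S x) = (-1) ^ a * ∑ A ∈ Finset.powersetCard a S, ∏ j ∈ A, x j := by
  have hexpand : esymmSeries S x =
      ∑ A ∈ S.powerset, C ((-1) ^ A.card * ∏ j ∈ A, x j) * X ^ A.card := by
    simp only [esymmSeries, sub_eq_add_neg, Finset.prod_one_add]
    refine Finset.sum_congr rfl fun A _ => ?_
    simp [Finset.prod_neg, Finset.prod_mul_distrib, mul_assoc]
  simp only [hexpand, map_sum, coeff_C_mul, coeff_X_pow, mul_ite, mul_one, mul_zero]
  rw [← Finset.sum_filter, Finset.mul_sum, Finset.powersetCard_eq_filter]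
  refine Finset.sum_congr (by simp only [eq_comm]) fun A hA => ?_
  rw [(Finset.mem_filter.1 hA).2]

end ElementarySymmetric

section PartialFractions

variable {R ι : Type*} [CommRing R] [DecidableEq ι]

theorem degree_C_mul_prod_erase_lt {S : Finset ι} (x : ι → R) (w : R) {m : ι} (hm : m ∈ S) :
    (Polynomial.C w * ∏ n ∈ S.erase m, (1 - Polynomial.C (x n) * Polynomial.X)).degree <
      S.card := by
  have hfactor : ∀ n ∈ S.erase m, (1 - Polynomial.C (x n) * Polynomial.X).natDegree ≤ 1 :=
    fun n _ => by compute_degree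
  have hprod : (∏ n ∈ S.erase m, (1 - Polynomial.C (x n) * Polynomial.X)).natDegree ≤
      (S.erase m).card :=
    (Polynomial.natDegree_prod_le _ _).trans ((Finset.sum_le_sum hfactor).trans (by simp))
  refine Polynomial.degree_le_natDegree.trans_lt ?_
  exact_mod_cast ((Polynomial.natDegree_C_mul_le w _).trans hprod).trans_lt
    (Finset.card_erase_lt_of_mem hm)

variable [IsDomain R] {S : Finset ι} {x z w : ι → R}

theorem sum_C_mul_prod_erase_eq_one (hS : S.Nonempty) (hz : Set.InjOn z S)
    (hx : ∀ n ∈ S, x n * z n = 1) (hw : ∀ m ∈ S, w m * ∏ n ∈ S.erase m, (1 - x n * z m) = 1) :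
    ∑ m ∈ S, Polynomial.C (w m) * ∏ n ∈ S.erase m, (1 - Polynomial.C (x n) * Polynomial.X) = 1 := by
  refine Polynomial.eq_of_degrees_lt_of_eval_index_eq S hz ?_ ?_ fun m hm => ?_
  · refine (Polynomial.degree_sum_le _ _).trans_lt ?_
    rw [Finset.sup_lt_iff (WithBot.bot_lt_coe _)]
    exact fun m hm => degree_C_mul_prod_erase_lt x (w m) hm
  · rw [Polynomial.degree_one]
    exact_mod_cast hS.card_pos
  · rw [Polynomial.eval_finsetSum, Finset.sum_eq_single_of_mem m hm]
    · simpa [Polynomial.eval_prod] using hw m hm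
    · intro l _ hlm
      rw [Polynomial.eval_mul, Polynomial.eval_prod,
        Finset.prod_eq_zero (Finset.mem_erase.2 ⟨hlm.symm, hm⟩), mul_zero]
      simp [hx m hm]

theorem hsymmSeries_eq_sum_C_mul_geomSeries (hS : S.Nonempty) (hz : Set.InjOn z S)
    (hx : ∀ n ∈ S, x n * z n = 1) (hw : ∀ m ∈ S, w m * ∏ n ∈ S.erase m, (1 - x n * z m) = 1) :
    hsymmSeries S x = ∑ m ∈ S, C (w m) * geomSeries (x m) := by
  have hone := congrArg (Polynomial.coeToPowerSeries.ringHom (R := R))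
    (sum_C_mul_prod_erase_eq_one hS hz hx hw)
  simp only [map_sum, map_mul, map_prod, map_sub, map_one,
    Polynomial.coeToPowerSeries.ringHom_apply, Polynomial.coe_C, Polynomial.coe_X] at hone
  rw [← mul_one (hsymmSeries S x), ← hone, Finset.mul_sum]
  refine Finset.sum_congr rfl fun m hm => ?_
  have hcancel : (∏ n ∈ S.erase m, geomSeries (x n)) *
      ∏ n ∈ S.erase m, (1 - C (x n) * X) = 1 := by
    rw [← Finset.prod_mul_distrib]
    exact Finset.prod_eq_one fun n _ => by rw [mul_comm, one_sub_C_mul_X_mul_geomSeries]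
  rw [hsymmSeries, ← Finset.mul_prod_erase S _ hm]
  linear_combination (geomSeries (x m) * C (w m)) * hcancel

end PartialFractions

section Nodes

variable {R : Type*} [CommRing R]

/-- The node `(n + 1) (n + 1 - x)`. For `x = X` the power sums of the inverse nodes have zeta values
as coefficients, while the inverse powers of a single node expand into the sums of the theorem. -/
def node (x : R) (n : ℕ) : R := (n + 1) * (n + 1 - x)

theorem node_def (x : R) (n : ℕ) : node x n = (n + 1) * (n + 1 - x) := rfl

theorem node_sub_node (x : R) (n m : ℕ) :
    node x n - node x m = (n - m) * (n + m + 2 - x) := by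
  simp only [node]
  ring

theorem prod_range_sub_natCast (m : ℕ) :
    ∏ n ∈ Finset.range m, ((m : R) - n) = ∏ n ∈ Finset.range m, ((n : R) + 1) := by
  induction m with
  | zero => simp
  | succ m ih =>
    rw [Finset.prod_range_succ', Finset.prod_range_succ _ m, ← ih]
    simp

theorem prod_range_natCast_sub (m : ℕ) :
    ∏ n ∈ Finset.range m, ((n : R) - m) = (-1) ^ m * ∏ n ∈ Finset.range m, ((n : R) + 1) := by
  rw [← prod_range_sub_natCast]
  simpa using Finset.prod_neg (s := Finset.range m) fun n : ℕ => (m : R) - n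

theorem prod_range_node_sub_node (x : R) (m : ℕ) :
    (-1) ^ m * (2 * (m + 1) - x) * (∏ j ∈ Finset.range m, (j + 1 - x)) *
      (∏ n ∈ Finset.range (m + 1), (((m + 1 : ℕ) : R) - n)) *
      ∏ n ∈ Finset.range m, (node x n - node x m) =
    (m + 1) * (∏ j ∈ Finset.range m, ((j : R) + 1)) *
      (∏ n ∈ Finset.range (m + 1), (((m + 1 : ℕ) : R) + n + 1 - x)) *
      ∏ n ∈ Finset.range m, node x n := by
  have hsign : (-1 : R) ^ m * (-1) ^ m = 1 := pow_mul_pow_eq_one m (by simp)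
  have hshift : ∏ n ∈ Finset.range (m + 1), (((m + 1 : ℕ) : R) + n + 1 - x) =
      (2 * (m + 1) - x) * ∏ n ∈ Finset.range m, ((n : R) + m + 2 - x) := by
    rw [Finset.prod_range_succ, mul_comm]
    congr 1
    · push_cast; ring
    · exact Finset.prod_congr rfl fun n _ => by push_cast; ring
  simp only [node_sub_node, Finset.prod_mul_distrib, prod_range_natCast_sub]
  rw [prod_range_sub_natCast, Finset.prod_range_succ, hshift]
  simp only [node, Finset.prod_mul_distrib]
  linear_combination ((2 * (m + 1) - x) * (∏ j ∈ Finset.range m, ((j : R) + 1 - x)) *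
    (∏ n ∈ Finset.range m, ((n : R) + 1)) ^ 2 * (m + 1) *
    ∏ n ∈ Finset.range m, ((n : R) + m + 2 - x)) * hsign

-- Solved for the products over the other nodes, this evaluates the partial fraction weight of the
-- node `m` among the first `N` nodes; without denominators it holds in every commutative ring.
theorem prod_erase_node_sub_node (x : R) {m N : ℕ} (h : m + 1 ≤ N) :
    (-1) ^ m * (2 * (m + 1) - x) * (∏ j ∈ Finset.range m, (j + 1 - x)) *
      (∏ n ∈ Finset.range (m + 1), ((N : R) - n)) *
      ∏ n ∈ (Finset.range N).erase m, (node x n - node x m) =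
    (m + 1) * (∏ j ∈ Finset.range m, ((j : R) + 1)) *
      (∏ n ∈ Finset.range (m + 1), ((N : R) + n + 1 - x)) *
      ∏ n ∈ (Finset.range N).erase m, node x n := by
  induction N, h using Nat.le_induction with
  | base =>
    rw [Finset.range_add_one, Finset.erase_insert Finset.notMem_range_self,
      ← Finset.range_add_one]
    exact prod_range_node_sub_node x m
  | succ N hN ih =>
    have hNm : N ≠ m := by omega
    have hnum : (∏ n ∈ Finset.range (m + 1), (((N + 1 : ℕ) : R) - n)) * (N - m) =
        (N + 1) * ∏ n ∈ Finset.range (m + 1), ((N : R) - n) := by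
      rw [Finset.prod_range_succ', Finset.prod_range_succ _ m]
      push_cast
      simp only [add_sub_add_right_eq_sub]
      ring
    have hden : (∏ n ∈ Finset.range (m + 1), (((N + 1 : ℕ) : R) + n + 1 - x)) * (N + 1 - x) =
        (N + m + 2 - x) * ∏ n ∈ Finset.range (m + 1), ((N : R) + n + 1 - x) := by
      rw [Finset.prod_range_succ, Finset.prod_range_succ' _ m,
        Finset.prod_congr rfl fun n _ => show ((N + 1 : ℕ) : R) + n + 1 - x =
          N + (n + 1 : ℕ) + 1 - x by push_cast; ring]
      push_cast
      ring
    rw [Finset.range_add_one (n := N), Finset.erase_insert_of_ne hNm, Finset.prod_insert (by simp),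
      Finset.prod_insert (by simp), node_sub_node, node_def x N]
    linear_combination (N + 1) * (N + m + 2 - x) * ih +
      ((-1) ^ m * (2 * (m + 1) - x) * (∏ j ∈ Finset.range m, (j + 1 - x)) * (N + m + 2 - x) *
        ∏ n ∈ (Finset.range N).erase m, (node x n - node x m)) * hnum -
      ((m + 1) * (∏ j ∈ Finset.range m, ((j : R) + 1)) * (N + 1) *
        ∏ n ∈ (Finset.range N).erase m, node x n) * hden

end Nodes

section Weights

/-- The limit as `N → ∞` of the weight of the node `m` in the partial fractions of
`∏ n < N, (1 - (node X n)⁻¹ Y)⁻¹`. -/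
noncomputable def limitWeight (m : ℕ) : ℂ⟦X⟧ :=
  (-1) ^ m * (2 - C ((m : ℂ) + 1)⁻¹ * X) *
    esymmSeries (Finset.range m) fun j => ((j : ℂ) + 1)⁻¹

/-- The ratio `∏ n ≤ m, (N - n) / (N + n + 1 - X)` of the partial fraction weight of the node `m`
among the first `N` nodes to its limit. -/
noncomputable def weightRatio (N m : ℕ) : ℂ⟦X⟧ :=
  ∏ n ∈ Finset.range (m + 1),
    C (((N : ℂ) - n) / ((N : ℂ) + n + 1)) * geomSeries ((N : ℂ) + n + 1)⁻¹

theorem C_mul_one_sub_C_inv_mul_X {K : Type*} [Field K] {c : K} (hc : c ≠ 0) :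
    C c * (1 - C c⁻¹ * X) = C c - X := by
  rw [mul_sub, mul_one, ← mul_assoc, ← map_mul, mul_inv_cancel₀ hc, map_one, one_mul]

theorem C_sub_X_mul_geomSeries {K : Type*} [Field K] {c : K} (hc : c ≠ 0) :
    (C c - X) * geomSeries c⁻¹ = C c := by
  rw [← C_mul_one_sub_C_inv_mul_X hc, mul_assoc, one_sub_C_mul_X_mul_geomSeries, mul_one]

theorem constantCoeff_node_X (n : ℕ) : constantCoeff (node (X : ℂ⟦X⟧) n) = ((n : ℂ) + 1) ^ 2 := by
  simp [node, sq]

theorem constantCoeff_node_X_ne_zero (n : ℕ) : constantCoeff (node (X : ℂ⟦X⟧) n) ≠ 0 := by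
  rw [constantCoeff_node_X]
  exact pow_ne_zero 2 n.cast_add_one_ne_zero

theorem inv_node_X (n : ℕ) :
    (node (X : ℂ⟦X⟧) n)⁻¹ = C (((n : ℂ) + 1)⁻¹ ^ 2) * geomSeries ((n : ℂ) + 1)⁻¹ := by
  have hn : (n : ℂ) + 1 ≠ 0 := n.cast_add_one_ne_zero
  have hnode : node (X : ℂ⟦X⟧) n = C ((n : ℂ) + 1) * (C ((n : ℂ) + 1) - X) := by simp [node]
  have hC : C (((n : ℂ) + 1)⁻¹ ^ 2) * (C ((n : ℂ) + 1) * C ((n : ℂ) + 1)) = 1 := by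
    rw [← map_mul, ← map_mul, ← sq, ← mul_pow, inv_mul_cancel₀ hn, one_pow, map_one]
  rw [PowerSeries.inv_eq_iff_mul_eq_one (constantCoeff_node_X_ne_zero n), hnode]
  linear_combination hC + C (((n : ℂ) + 1)⁻¹ ^ 2) * C ((n : ℂ) + 1) * C_sub_X_mul_geomSeries hn

theorem node_X_injective : Function.Injective (node (X : ℂ⟦X⟧)) := by
  intro n m h
  have hsq := congrArg constantCoeff h
  simp only [constantCoeff_node_X] at hsq
  exact Nat.succ_injective (Nat.pow_left_injective two_ne_zero (by exact_mod_cast hsq))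

theorem mul_limitWeight (m : ℕ) :
    ((m : ℂ⟦X⟧) + 1) * (∏ j ∈ Finset.range m, ((j : ℂ⟦X⟧) + 1)) * limitWeight m =
      (-1) ^ m * (2 * ((m : ℂ⟦X⟧) + 1) - X) * ∏ j ∈ Finset.range m, ((j : ℂ⟦X⟧) + 1 - X) := by
  have hlin : ((m : ℂ⟦X⟧) + 1) * (2 - C ((m : ℂ) + 1)⁻¹ * X) = 2 * ((m : ℂ⟦X⟧) + 1) - X := by
    have h := C_mul_one_sub_C_inv_mul_X (m.cast_add_one_ne_zero (R := ℂ))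
    simp only [map_add, map_natCast, map_one] at h
    linear_combination h
  have hprod : (∏ j ∈ Finset.range m, ((j : ℂ⟦X⟧) + 1)) *
      esymmSeries (Finset.range m) (fun j => ((j : ℂ) + 1)⁻¹) =
      ∏ j ∈ Finset.range m, ((j : ℂ⟦X⟧) + 1 - X) := by
    rw [esymmSeries, ← Finset.prod_mul_distrib]
    refine Finset.prod_congr rfl fun j _ => ?_
    simpa using C_mul_one_sub_C_inv_mul_X (j.cast_add_one_ne_zero (R := ℂ))
  rw [limitWeight]
  linear_combination (-1) ^ m * (2 - C ((m : ℂ) + 1)⁻¹ * X) * (m + 1) * hprod +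
    (-1) ^ m * (∏ j ∈ Finset.range m, ((j : ℂ⟦X⟧) + 1 - X)) * hlin

theorem weightRatio_mul_prod (N m : ℕ) :
    weightRatio N m * ∏ n ∈ Finset.range (m + 1), ((N : ℂ⟦X⟧) + n + 1 - (X : ℂ⟦X⟧)) =
      ∏ n ∈ Finset.range (m + 1), ((N : ℂ⟦X⟧) - n) := by
  rw [weightRatio, ← Finset.prod_mul_distrib]
  refine Finset.prod_congr rfl fun n _ => ?_
  have hc : (N : ℂ) + n + 1 ≠ 0 := by exact_mod_cast (N + n).succ_ne_zero
  have hgeom := C_sub_X_mul_geomSeries hc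
  have hquot : C (((N : ℂ) - n) / ((N : ℂ) + n + 1)) * C ((N : ℂ) + n + 1) = C ((N : ℂ) - n) := by
    rw [← map_mul, div_mul_cancel₀ _ hc]
  simp only [map_add, map_sub, map_natCast, map_one] at hgeom hquot
  linear_combination C (((N : ℂ) - n) / ((N : ℂ) + n + 1)) * hgeom + hquot

theorem prod_one_sub_inv_node_mul (N m : ℕ) :
    (∏ n ∈ (Finset.range N).erase m, (1 - (node X n)⁻¹ * node (X : ℂ⟦X⟧) m)) *
      ∏ n ∈ (Finset.range N).erase m, node X n =
    ∏ n ∈ (Finset.range N).erase m, (node X n - node X m) := by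
  rw [← Finset.prod_mul_distrib]
  refine Finset.prod_congr rfl fun n _ => ?_
  linear_combination -node X m * PowerSeries.inv_mul_cancel _ (constantCoeff_node_X_ne_zero n)

theorem limitWeight_mul_weightRatio_mul_prod {N m : ℕ} (h : m < N) :
    limitWeight m * weightRatio N m *
      ∏ n ∈ (Finset.range N).erase m, (1 - (node X n)⁻¹ * node X m) = 1 := by
  have hD : ((m : ℂ⟦X⟧) + 1) * (∏ j ∈ Finset.range m, ((j : ℂ⟦X⟧) + 1)) *
      (∏ n ∈ Finset.range (m + 1), ((N : ℂ⟦X⟧) + n + 1 - (X : ℂ⟦X⟧))) *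
      ∏ n ∈ (Finset.range N).erase m, node X n ≠ 0 := by
    refine ne_zero_of_map (f := constantCoeff) ?_
    have hsucc (k l : ℕ) : (k : ℂ) + l + 1 ≠ 0 := by exact_mod_cast (k + l).succ_ne_zero
    simp [constantCoeff_node_X, Finset.prod_ne_zero_iff, Nat.cast_add_one_ne_zero, hsucc]
  refine mul_right_cancel₀ hD ?_
  calc _ = (((m : ℂ⟦X⟧) + 1) * (∏ j ∈ Finset.range m, ((j : ℂ⟦X⟧) + 1)) * limitWeight m) *
        (weightRatio N m * ∏ n ∈ Finset.range (m + 1), ((N : ℂ⟦X⟧) + n + 1 - (X : ℂ⟦X⟧))) *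
        ((∏ n ∈ (Finset.range N).erase m, (1 - (node X n)⁻¹ * node (X : ℂ⟦X⟧) m)) *
          ∏ n ∈ (Finset.range N).erase m, node X n) := by ring
    _ = _ := by
      rw [mul_limitWeight, weightRatio_mul_prod, prod_one_sub_inv_node_mul,
        prod_erase_node_sub_node X h, one_mul]

theorem coeff_hsymmSeries_inv_node {N : ℕ} (hN : 0 < N) (s : ℕ) :
    coeff s (hsymmSeries (Finset.range N) fun n => (node (X : ℂ⟦X⟧) n)⁻¹) =
      ∑ m ∈ Finset.range N, limitWeight m * weightRatio N m * (node X m)⁻¹ ^ s := by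
  rw [hsymmSeries_eq_sum_C_mul_geomSeries (z := node X)
    (w := fun m => limitWeight m * weightRatio N m) ⟨0, Finset.mem_range.2 hN⟩
    node_X_injective.injOn
    (fun n _ => PowerSeries.inv_mul_cancel _ (constantCoeff_node_X_ne_zero n))
    (fun m hm => limitWeight_mul_weightRatio_mul_prod (Finset.mem_range.1 hm)), map_sum]
  simp_rw [coeff_C_mul, coeff_geomSeries]

end Weights

section CoefficientBounds

variable {R : Type*} [SeminormedCommRing R] {a b : ℝ} {f g : R⟦X⟧}

/-- The coefficient of `X ^ r` in `f` has norm at most `a ^ r` for all `r`. Exponents add up under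
products, so this bounds the coefficients of long products of linear factors. -/
def CoeffLePow (a : ℝ) (f : R⟦X⟧) : Prop := ∀ r, ‖coeff r f‖ ≤ a ^ r

namespace CoeffLePow

theorem nonneg (hf : CoeffLePow a f) : 0 ≤ a := by
  simpa using (norm_nonneg _).trans (hf 1)

theorem mono (hf : CoeffLePow a f) (h : a ≤ b) : CoeffLePow b f :=
  fun r => (hf r).trans (pow_le_pow_left₀ hf.nonneg h r)

theorem mul (hf : CoeffLePow a f) (hg : CoeffLePow b g) : CoeffLePow (a + b) (f * g) := by
  intro r
  have ha := hf.nonneg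
  have hb := hg.nonneg
  rw [coeff_mul, (Commute.all a b).add_pow']
  refine norm_sum_le_of_le _ fun p hp => ?_
  rw [Finset.HasAntidiagonal.mem_antidiagonal] at hp
  have hchoose : (1 : ℝ) ≤ r.choose p.1 := by exact_mod_cast Nat.choose_pos (by omega)
  calc ‖coeff p.1 f * coeff p.2 g‖ ≤ ‖coeff p.1 f‖ * ‖coeff p.2 g‖ := norm_mul_le _ _
    _ ≤ a ^ p.1 * b ^ p.2 := mul_le_mul (hf _) (hg _) (norm_nonneg _) (by positivity)
    _ ≤ r.choose p.1 • (a ^ p.1 * b ^ p.2) := by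
      rw [nsmul_eq_mul]
      exact le_mul_of_one_le_left (by positivity) hchoose

theorem C_mul (hf : CoeffLePow a f) {c : R} (hc : ‖c‖ ≤ 1) : CoeffLePow a (C c * f) := by
  intro r
  rw [coeff_C_mul]
  exact (norm_mul_le _ _).trans ((mul_le_of_le_one_left (norm_nonneg _) hc).trans (hf r))

end CoeffLePow

variable [NormOneClass R]

theorem coeffLePow_one : CoeffLePow 0 (1 : R⟦X⟧) := by
  intro r
  rcases r with _ | r <;> simp [coeff_one]

theorem coeffLePow_geomSeries (c : R) : CoeffLePow ‖c‖ (geomSeries c) := by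
  intro r
  rw [coeff_geomSeries]
  exact norm_pow_le c r

theorem coeffLePow_one_sub_C_mul_X (c : R) : CoeffLePow ‖c‖ (1 - C c * X) := by
  intro r
  rcases r with _ | _ | r
  · simp
  · simp [coeff_one, coeff_succ_mul_X]
  · simp [coeff_one, coeff_succ_mul_X]

namespace CoeffLePow

theorem prod {ι : Type*} {S : Finset ι} {a : ι → ℝ} {f : ι → R⟦X⟧}
    (h : ∀ i ∈ S, CoeffLePow (a i) (f i)) : CoeffLePow (∑ i ∈ S, a i) (∏ i ∈ S, f i) := by
  classical
  induction S using Finset.induction_on with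
  | empty => exact coeffLePow_one
  | insert i S hi ih =>
    rw [Finset.sum_insert hi, Finset.prod_insert hi]
    exact (h i (Finset.mem_insert_self i S)).mul
      (ih fun j hj => h j (Finset.mem_insert_of_mem hj))

theorem pow (hf : CoeffLePow a f) (s : ℕ) : CoeffLePow (s * a) (f ^ s) := by
  simpa using prod (S := Finset.range s) fun _ _ => hf

end CoeffLePow

theorem coeffLePow_esymmSeries {ι : Type*} (S : Finset ι) (x : ι → R) :
    CoeffLePow (∑ n ∈ S, ‖x n‖) (esymmSeries S x) :=
  CoeffLePow.prod fun n _ => coeffLePow_one_sub_C_mul_X (x n)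

end CoefficientBounds

section HarmonicBounds

theorem sum_range_inv_add_one (m : ℕ) :
    ∑ n ∈ Finset.range m, ((n : ℝ) + 1)⁻¹ = (harmonic m : ℝ) := by
  simp [harmonic]

open Filter Asymptotics in
theorem summable_harmonic_pow_mul_inv_sq (b c : ℝ) (r : ℕ) :
    Summable fun n : ℕ => (b * harmonic n + c) ^ r * ((n : ℝ) ^ 2)⁻¹ := by
  have hone : (fun _ : ℕ => (1 : ℝ)) =O[atTop] fun n : ℕ => Real.log n :=
    (Real.isLittleO_const_log_atTop.comp_tendsto tendsto_natCast_atTop_atTop).isBigO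
  have hharmonic : (fun n : ℕ => (harmonic n : ℝ)) =O[atTop] fun n : ℕ => Real.log n := by
    refine IsBigO.trans (.of_bound' (.of_forall fun n => ?_)) (hone.add (isBigO_refl _ _))
    exact Real.norm_of_nonneg (by rw [← sum_range_inv_add_one]; positivity) |>.trans_le
      ((harmonic_le_one_add_log n).trans (le_abs_self _))
  have hlin : (fun n : ℕ => b * harmonic n + c) =O[atTop] fun n : ℕ => Real.log n := by
    refine (hharmonic.const_mul_left b).add ?_
    simpa using hone.const_mul_left c
  have hpow : (fun n : ℕ => (b * harmonic n + c) ^ r) =O[atTop]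
      fun n : ℕ => (n : ℝ) ^ (1 / 2 : ℝ) := by
    refine (hlin.pow r).trans ?_
    simpa [Function.comp_def] using ((isLittleO_log_rpow_rpow_atTop r
      (one_half_pos (α := ℝ))).comp_tendsto tendsto_natCast_atTop_atTop).isBigO
  refine summable_of_isBigO_nat (g := fun n : ℕ => (n : ℝ) ^ (-(3 / 2) : ℝ))
    (Real.summable_nat_rpow.2 (by norm_num)) ?_
  refine (hpow.mul (isBigO_refl _ _)).congr' .rfl ?_
  filter_upwards [eventually_gt_atTop 0] with n hn
  rw [← Real.rpow_natCast, ← Real.rpow_neg n.cast_nonneg, ← Real.rpow_add (by positivity)]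
  norm_num

theorem summable_harmonic_succ_pow_mul_inv_sq (b c : ℝ) (r : ℕ) :
    Summable fun m : ℕ => (b * harmonic (m + 1) + c) ^ r * ((m : ℝ) + 1)⁻¹ ^ 2 := by
  simpa using (summable_nat_add_iff 1).2 (summable_harmonic_pow_mul_inv_sq b c r)

end HarmonicBounds

section Limit

theorem norm_inv_natCast_add_one (m : ℕ) : ‖((m : ℂ) + 1)⁻¹‖ = ((m : ℝ) + 1)⁻¹ := by
  rw [norm_inv]
  exact_mod_cast congrArg (·⁻¹) (Complex.norm_natCast (m + 1))

theorem limitWeight_mul_inv_node_pow (m s : ℕ) :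
    limitWeight m * (node X m)⁻¹ ^ s =
      C ((-1) ^ m * ((m : ℂ) + 1)⁻¹ ^ (2 * s)) *
        (rescale ((m : ℂ) + 1)⁻¹ ((2 - X) * geomSeries 1 ^ s) *
          esymmSeries (Finset.range m) fun j => ((j : ℂ) + 1)⁻¹) := by
  rw [limitWeight, inv_node_X]
  simp only [map_mul, map_sub, map_pow, map_neg, map_one, map_ofNat, rescale_X, rescale_geomSeries,
    mul_one]
  ring

theorem coeffLePow_weightRatio (N m : ℕ) : CoeffLePow (harmonic (m + 1) : ℝ) (weightRatio N m) := by
  rw [← sum_range_inv_add_one]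
  refine CoeffLePow.prod fun n _ => ?_
  have hnorm : ‖(N : ℂ) + n + 1‖ = (N : ℝ) + n + 1 := by
    exact_mod_cast Complex.norm_natCast (N + n + 1)
  refine ((coeffLePow_geomSeries _).mono ?_).C_mul ?_
  · rw [norm_inv, hnorm]
    gcongr
    linarith [N.cast_nonneg (α := ℝ)]
  · rw [norm_div, hnorm]
    refine div_le_one_of_le₀ ((norm_sub_le _ _).trans ?_) (by positivity)
    rw [Complex.norm_natCast, Complex.norm_natCast]
    linarith

theorem coeffLePow_esymmSeries_inv (m : ℕ) :
    CoeffLePow (harmonic m : ℝ)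
      (esymmSeries (Finset.range m) fun j => ((j : ℂ) + 1)⁻¹) := by
  have h := coeffLePow_esymmSeries (Finset.range m) fun j : ℕ => ((j : ℂ) + 1)⁻¹
  simpa only [norm_inv_natCast_add_one, sum_range_inv_add_one] using h

theorem limitWeight_mul_weightRatio_mul_inv_node_pow (N m s : ℕ) :
    limitWeight m * weightRatio N m * (node X m)⁻¹ ^ s =
      C (2 * (-1) ^ m * ((m : ℂ) + 1)⁻¹ ^ (2 * s)) * ((1 - C (((m : ℂ) + 1)⁻¹ / 2) * X) *
        (esymmSeries (Finset.range m) fun j => ((j : ℂ) + 1)⁻¹) * weightRatio N m *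
        geomSeries ((m : ℂ) + 1)⁻¹ ^ s) := by
  set a : ℂ := ((m : ℂ) + 1)⁻¹ with ha
  have hhalf : 2 * C (a / 2) = C a := by
    rw [← map_ofNat C 2, ← map_mul, mul_div_cancel₀ _ two_ne_zero]
  rw [mul_right_comm, limitWeight_mul_inv_node_pow, ← ha]
  simp only [map_mul, map_sub, map_pow, rescale_X, rescale_geomSeries, map_ofNat, mul_one]
  linear_combination (C (-1) ^ m * C a ^ (2 * s) * weightRatio N m * geomSeries a ^ s *
    (esymmSeries (Finset.range m) fun j => ((j : ℂ) + 1)⁻¹) * X) * hhalf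

theorem norm_coeff_limitWeight_mul_le {s : ℕ} (hs : 1 ≤ s) (N m r : ℕ) :
    ‖coeff r (limitWeight m * weightRatio N m * (node X m)⁻¹ ^ s)‖ ≤
      2 * ((2 * harmonic (m + 1) + s) ^ r * ((m : ℝ) + 1)⁻¹ ^ 2) := by
  set a : ℂ := ((m : ℂ) + 1)⁻¹
  have hnorm : ‖a‖ = ((m : ℝ) + 1)⁻¹ := norm_inv_natCast_add_one m
  have ha1 : ‖a‖ ≤ 1 := by
    rw [hnorm]
    exact inv_le_one_of_one_le₀ (by linarith [m.cast_nonneg (α := ℝ)])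
  have hexp : ‖a / 2‖ + harmonic m + harmonic (m + 1) + s * ‖a‖ ≤ 2 * harmonic (m + 1) + s := by
    have hsucc : (harmonic (m + 1) : ℝ) = harmonic m + ‖a‖ := by
      rw [hnorm, harmonic_succ]
      push_cast
      rfl
    have hhalf : ‖a / 2‖ ≤ ‖a‖ := by
      rw [norm_div, Complex.norm_ofNat]
      exact half_le_self (norm_nonneg a)
    have hmul : s * ‖a‖ ≤ s := mul_le_of_le_one_right s.cast_nonneg ha1
    linarith
  have hcoeff := ((((coeffLePow_one_sub_C_mul_X (a / 2)).mul (coeffLePow_esymmSeries_inv m)).mul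
    (coeffLePow_weightRatio N m)).mul ((coeffLePow_geomSeries a).pow s)).mono hexp r
  have hconst : ‖2 * (-1) ^ m * a ^ (2 * s)‖ ≤ 2 * ‖a‖ ^ 2 := by
    simpa using pow_le_pow_of_le_one (norm_nonneg a) ha1 (by omega : 2 ≤ 2 * s)
  rw [limitWeight_mul_weightRatio_mul_inv_node_pow, coeff_C_mul, norm_mul, ← hnorm]
  refine (mul_le_mul hconst hcoeff (norm_nonneg _) (by positivity)).trans_eq ?_
  ring

open Filter Topology PowerSeries.WithPiTopology

theorem continuous_geomSeries {R : Type*} [CommRing R] [TopologicalSpace R] [ContinuousMul R] :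
    Continuous (geomSeries : R → R⟦X⟧) := by
  refine continuous_iff_continuousAt.2 fun a => ?_
  rw [ContinuousAt, tendsto_iff_coeff_tendsto]
  intro r
  simpa using (continuous_pow r).tendsto a

theorem tendsto_weightRatio (m : ℕ) : Tendsto (weightRatio · m) atTop (𝓝 1) := by
  have hinv (n : ℕ) : Tendsto (fun N : ℕ => ((N : ℂ) + n + 1)⁻¹) atTop (𝓝 0) := by
    have h := (tendsto_inv_atTop_nhds_zero_nat (𝕜 := ℂ)).comp (tendsto_add_atTop_nat (n + 1))
    simpa [Function.comp_def, add_assoc] using h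
  have hquot (n : ℕ) : Tendsto (fun N : ℕ => ((N : ℂ) - n) / ((N : ℂ) + n + 1)) atTop (𝓝 1) := by
    have h := ((hinv n).const_mul (2 * (n : ℂ) + 1)).const_sub 1
    rw [mul_zero, sub_zero] at h
    refine h.congr fun N => ?_
    have hN : (N : ℂ) + n + 1 ≠ 0 := by exact_mod_cast (N + n).succ_ne_zero
    field_simp
    ring
  have hfactor (n : ℕ) := ((continuous_C (R := ℂ)).tendsto 1).comp (hquot n) |>.mul
    ((continuous_geomSeries.tendsto 0).comp (hinv n))
  have hzero : geomSeries (0 : ℂ) = 1 := by simpa using one_sub_C_mul_X_mul_geomSeries (0 : ℂ)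
  simpa [hzero, weightRatio] using tendsto_finsetProd (Finset.range (m + 1)) fun n _ => hfactor n

theorem weightRatio_eq_zero {N m : ℕ} (h : N ≤ m) : weightRatio N m = 0 :=
  Finset.prod_eq_zero (Finset.mem_range.2 (Nat.lt_succ_of_le h)) (by simp)

theorem tendsto_coeff_coeff_hsymmSeries {s : ℕ} (hs : 1 ≤ s) (r : ℕ) :
    Tendsto (fun N => coeff r (coeff s
        (hsymmSeries (Finset.range N) fun n => (node (X : ℂ⟦X⟧) n)⁻¹)))
      atTop (𝓝 (∑' m, coeff r (limitWeight m * (node X m)⁻¹ ^ s))) := by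
  have hterm (m : ℕ) : Tendsto
      (fun N => coeff r (limitWeight m * weightRatio N m * (node X m)⁻¹ ^ s)) atTop
      (𝓝 (coeff r (limitWeight m * (node X m)⁻¹ ^ s))) := by
    have h := ((tendsto_weightRatio m).const_mul (limitWeight m)).mul_const ((node X m)⁻¹ ^ s)
    rw [mul_one] at h
    exact ((continuous_coeff ℂ r).tendsto _).comp h
  refine (tendsto_tsum_of_dominated_convergence
    ((summable_harmonic_succ_pow_mul_inv_sq 2 s r).mul_left 2) hterm
    (.of_forall fun N m => norm_coeff_limitWeight_mul_le hs N m r)).congr' ?_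
  filter_upwards [eventually_gt_atTop 0] with N hN
  rw [coeff_hsymmSeries_inv_node hN, map_sum, tsum_eq_sum]
  intro m hm
  rw [weightRatio_eq_zero (by simpa using hm), mul_zero, zero_mul, map_zero]

end Limit

section ZetaAlgebra

/-- The `ℚ`-algebra generated by the zeta values `ζ(2), ζ(3), …`. -/
noncomputable def zetaAlgebra : Subalgebra ℚ ℂ :=
  (MvPolynomial.aeval fun k : {k : ℕ // 2 ≤ k} => riemannZeta (k.1 : ℂ)).range

theorem isRatPolyInZetaValues_iff_mem_zetaAlgebra {x : ℂ} :
    IsRatPolyInZetaValues x ↔ x ∈ zetaAlgebra :=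
  ⟨fun ⟨P, hP⟩ => ⟨P, hP.symm⟩, fun ⟨P, hP⟩ => ⟨P, hP.symm⟩⟩

theorem riemannZeta_mem_zetaAlgebra {k : ℕ} (hk : 2 ≤ k) : riemannZeta k ∈ zetaAlgebra :=
  ⟨MvPolynomial.X ⟨k, hk⟩, by simp⟩

theorem hasSum_inv_natCast_add_one_pow {k : ℕ} (hk : 2 ≤ k) :
    HasSum (fun n : ℕ => ((n : ℂ) + 1)⁻¹ ^ k) (riemannZeta k) := by
  have hsummable : Summable fun n : ℕ => 1 / (n : ℂ) ^ k := by
    simpa using (Complex.summable_one_div_nat_cpow (p := (k : ℂ))).2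
      (by simpa using Nat.lt_of_succ_le hk)
  have h := hsummable.hasSum
  rw [← zeta_nat_eq_tsum_of_gt_one hk, ← hasSum_nat_add_iff' 1] at h
  simpa [show k ≠ 0 by omega] using h

theorem mem_range_mapAlgHom_val {k A : Type*} [CommRing k] [CommRing A] [Algebra k A]
    {S : Subalgebra k A} {f : A⟦X⟧} :
    f ∈ (PowerSeries.mapAlgHom S.val).range ↔ ∀ r, coeff r f ∈ S := by
  constructor
  · rintro ⟨g, rfl⟩ r
    exact (coeff r g).2
  · refine fun h => ⟨PowerSeries.mk fun r => ⟨coeff r f, h r⟩, ?_⟩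
    ext r
    exact (coeff_map (S.val : S →+* A) r _).trans (congrArg Subtype.val (coeff_mk r _))

theorem coeff_inv_node_pow (n k r : ℕ) :
    coeff r ((node (X : ℂ⟦X⟧) n)⁻¹ ^ k) =
      ((intBinom (k - 1 + r) r : ℤ) : ℂ) * ((n : ℂ) + 1)⁻¹ ^ (2 * k + r) := by
  rw [inv_node_X, mul_pow, ← map_pow, coeff_C_mul, coeff_geomSeries_pow]
  ring

open Filter Topology PowerSeries.WithPiTopology in
theorem exists_tendsto_sum_inv_node_pow (k : ℕ) :
    ∃ p ∈ (PowerSeries.mapAlgHom zetaAlgebra.val).range,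
      Tendsto (fun N => ∑ n ∈ Finset.range N, (node (X : ℂ⟦X⟧) n)⁻¹ ^ (k + 1)) atTop (𝓝 p) := by
  let p : ℂ⟦X⟧ := PowerSeries.mk fun r =>
    ((intBinom ((k + 1 : ℕ) - 1 + r) r : ℤ) : ℂ) * riemannZeta ((2 * (k + 1) + r : ℕ) : ℂ)
  have hsum : HasSum (fun n => (node (X : ℂ⟦X⟧) n)⁻¹ ^ (k + 1)) p := by
    refine (hasSum_iff_hasSum_coeff ℂ).2 fun r => ?_
    simp only [p, coeff_mk, coeff_inv_node_pow]
    exact (hasSum_inv_natCast_add_one_pow (by omega)).mul_left _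
  refine ⟨p, mem_range_mapAlgHom_val.2 fun r => ?_, hsum.tendsto_sum_nat⟩
  rw [coeff_mk]
  exact mul_mem (intCast_mem _ _) (riemannZeta_mem_zetaAlgebra (by omega))

open Filter Topology PowerSeries.WithPiTopology in
theorem tsum_coeff_limitWeight_mul_mem_zetaAlgebra {s : ℕ} (hs : 1 ≤ s) (r : ℕ) :
    ∑' m, coeff r (limitWeight m * (node X m)⁻¹ ^ s) ∈ zetaAlgebra := by
  obtain ⟨y, hy, hlim⟩ := exists_tendsto_coeff_hsymmSeries _ exists_tendsto_sum_inv_node_pow s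
  rw [tendsto_nhds_unique (tendsto_coeff_coeff_hsymmSeries hs r)
    (((continuous_coeff ℂ r).tendsto y).comp hlim)]
  exact mem_range_mapAlgHom_val.1 hy r

end ZetaAlgebra

section Tuples

theorem strictMono_snoc {n : ℕ} {f : Fin n → ℕ} (hf : StrictMono f) {b : ℕ} (hb : ∀ i, f i < b) :
    StrictMono (Fin.snoc (α := fun _ => ℕ) f b) := by
  intro i j hij
  induction i using Fin.lastCases with
  | last => exact absurd hij (Fin.le_last j).not_gt
  | cast i =>
    induction j using Fin.lastCases with
    | last => simpa using hb i
    | cast j => simpa using hf (by simpa using hij)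

/-- The increasing tuple with last entry `m + 1` and the numbers `j + 1`, `j ∈ A`, before it. The
shift by one lets `m` and `A` range over the natural numbers from `0` on. -/
noncomputable def incTupleOfFinset {a : ℕ}
    (p : Σ m : ℕ, Finset.powersetCard a (Finset.range m)) : IncTuple a :=
  ⟨Fin.snoc (α := fun _ => ℕ)
    (fun i => p.2.1.orderEmbOfFin (Finset.mem_powersetCard.1 p.2.2).2 i + 1) (p.1 + 1),
    fun j => by refine Fin.lastCases ?_ (fun i => ?_) j <;> simp,
    strictMono_snoc (fun i j hij => by simpa using hij) fun i => by
      simpa using (Finset.mem_powersetCard.1 p.2.2).1 (Finset.orderEmbOfFin_mem _ _ i)⟩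

theorem incTupleOfFinset_injective (a : ℕ) : Function.Injective (incTupleOfFinset (a := a)) := by
  rintro ⟨m, A, hA⟩ ⟨n, B, hB⟩ h
  have hval := congrFun (congrArg Subtype.val h)
  obtain rfl : m = n := by simpa [incTupleOfFinset] using hval (Fin.last a)
  have hemb : ⇑(A.orderEmbOfFin (Finset.mem_powersetCard.1 hA).2) =
      B.orderEmbOfFin (Finset.mem_powersetCard.1 hB).2 :=
    funext fun i => by simpa [incTupleOfFinset] using hval i.castSucc
  obtain rfl : A = B := by
    rw [← Finset.coe_inj, ← Finset.range_orderEmbOfFin A (Finset.mem_powersetCard.1 hA).2, hemb,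
      Finset.range_orderEmbOfFin B]
  rfl

theorem incTupleOfFinset_surjective (a : ℕ) : Function.Surjective (incTupleOfFinset (a := a)) := by
  rintro ⟨t, hpos, hmono⟩
  have hlt (i : Fin a) : t i.castSucc - 1 < t (Fin.last a) - 1 := by
    have h₁ := hmono (Fin.castSucc_lt_last i)
    have h₂ := hpos i.castSucc
    omega
  have hinit : StrictMono fun i : Fin a => t i.castSucc - 1 := by
    intro i j hij
    have h₁ := hmono (Fin.castSucc_lt_castSucc_iff.2 hij)
    have h₂ := hpos i.castSucc
    change t i.castSucc - 1 < t j.castSucc - 1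
    omega
  set A : Finset ℕ := Finset.univ.image fun i : Fin a => t i.castSucc - 1 with hA
  have hcard : A.card = a := by
    rw [hA, Finset.card_image_of_injective _ hinit.injective, Finset.card_fin]
  have hmem : A ∈ Finset.powersetCard a (Finset.range (t (Fin.last a) - 1)) :=
    Finset.mem_powersetCard.2
      ⟨Finset.image_subset_iff.2 fun i _ => Finset.mem_range.2 (hlt i), hcard⟩
  have hemb := Finset.orderEmbOfFin_unique hcard
    (fun i => Finset.mem_image_of_mem _ (Finset.mem_univ i)) hinit
  refine ⟨⟨t (Fin.last a) - 1, A, hmem⟩, Subtype.ext (funext fun j => ?_)⟩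
  induction j using Fin.lastCases with
  | last => simpa [incTupleOfFinset] using Nat.sub_add_cancel (hpos (Fin.last a))
  | cast i =>
    simpa [incTupleOfFinset, ← hemb] using Nat.sub_add_cancel (hpos i.castSucc)

theorem incTupleOfFinset_bijective (a : ℕ) : Function.Bijective (incTupleOfFinset (a := a)) :=
  ⟨incTupleOfFinset_injective a, incTupleOfFinset_surjective a⟩

/-- Increasing tuples of depth `a + 1` are sets of `a` natural numbers together with a strict upper
bound. -/
noncomputable def incTupleEquiv (a : ℕ) :
    (Σ m : ℕ, Finset.powersetCard a (Finset.range m)) ≃ IncTuple a :=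
  .ofBijective incTupleOfFinset (incTupleOfFinset_bijective a)

theorem mplTerm_incTupleEquiv (z : ℂ) (a b : ℕ)
    (p : Σ m : ℕ, Finset.powersetCard a (Finset.range m)) :
    mplTerm z (onesThen a b) (incTupleEquiv a p) =
      z ^ p.1 * ((p.1 : ℂ) + 1)⁻¹ ^ b * ∏ j ∈ p.2.1, ((j : ℂ) + 1)⁻¹ := by
  obtain ⟨m, A, hA⟩ := p
  have hprod : ∏ j ∈ A, ((j : ℂ) + 1)⁻¹ = ∏ i : Fin a,
      ((A.orderEmbOfFin (Finset.mem_powersetCard.1 hA).2 i : ℂ) + 1)⁻¹ := by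
    conv_lhs => rw [← Finset.image_orderEmbOfFin_univ A (Finset.mem_powersetCard.1 hA).2]
    exact Finset.prod_image fun i _ j _ h => (A.orderEmbOfFin _).injective h
  rw [hprod, Finset.prod_inv_distrib, incTupleEquiv, Equiv.ofBijective_apply, mplTerm,
    Fin.prod_univ_castSucc]
  simp only [incTupleOfFinset, Fin.snoc_last, add_tsub_cancel_right, Fin.snoc_castSucc,
    Nat.cast_add, Nat.cast_one, onesThen, pow_one, inv_pow]
  ring

theorem sum_powersetCard_prod_inv_le (a m : ℕ) :
    ∑ A ∈ Finset.powersetCard a (Finset.range m), ∏ j ∈ A, ((j : ℝ) + 1)⁻¹ ≤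
      (harmonic m : ℝ) ^ a := by
  have h := coeffLePow_esymmSeries (Finset.range m) (fun j : ℕ => ((j : ℝ) + 1)⁻¹) a
  have hnorm (j : ℕ) : ‖((j : ℝ) + 1)⁻¹‖ = ((j : ℝ) + 1)⁻¹ := Real.norm_of_nonneg (by positivity)
  simp only [hnorm, sum_range_inv_add_one] at h
  rw [coeff_esymmSeries, norm_mul, norm_pow, norm_neg, norm_one, one_pow, one_mul] at h
  exact (Real.le_norm_self _).trans h

theorem summable_mplTerm_onesThen (a : ℕ) {b : ℕ} (hb : 2 ≤ b) :
    Summable (mplTerm (-1) (onesThen a b)) := by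
  rw [← (incTupleEquiv a).summable_iff]
  refine Summable.of_norm ((summable_sigma_of_nonneg fun _ => norm_nonneg _).2
    ⟨fun m => Summable.of_finite, ?_⟩)
  refine Summable.of_nonneg_of_le (fun m => tsum_nonneg fun _ => norm_nonneg _) (fun m => ?_)
    (summable_harmonic_succ_pow_mul_inv_sq 1 0 a)
  have hfiber : ∑' A : Finset.powersetCard a (Finset.range m),
      ‖mplTerm (-1) (onesThen a b) (incTupleEquiv a ⟨m, A⟩)‖ =
        ((m : ℝ) + 1)⁻¹ ^ b *
          ∑ A ∈ Finset.powersetCard a (Finset.range m), ∏ j ∈ A, ((j : ℝ) + 1)⁻¹ := by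
    simp only [mplTerm_incTupleEquiv, norm_mul, norm_pow, norm_neg, norm_one, one_pow, one_mul,
      norm_prod, norm_inv_natCast_add_one]
    rw [tsum_fintype, ← Finset.mul_sum, Finset.sum_coe_sort (Finset.powersetCard a _)
      fun A : Finset ℕ => ∏ j ∈ A, ((j : ℝ) + 1)⁻¹]
  have hharmonic : (0 : ℝ) ≤ harmonic m := by
    rw [← sum_range_inv_add_one]
    positivity
  have hmono : (harmonic m : ℝ) ≤ harmonic (m + 1) := by
    rw [harmonic_succ]
    push_cast
    linarith [inv_nonneg.2 (m.cast_add_one_pos (α := ℝ)).le]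
  have hinv : ((m : ℝ) + 1)⁻¹ ≤ 1 := inv_le_one_of_one_le₀ (by linarith [m.cast_nonneg (α := ℝ)])
  rw [Function.comp_def, hfiber, mul_comm, one_mul, add_zero]
  exact mul_le_mul ((sum_powersetCard_prod_inv_le a m).trans (by gcongr))
    (pow_le_pow_of_le_one (by positivity) hinv hb) (by positivity)
    (pow_nonneg (hharmonic.trans hmono) a)

theorem hasSum_zetaMinus_onesThen (a : ℕ) {b : ℕ} (hb : 2 ≤ b) :
    HasSum (fun m : ℕ => (-1) ^ m * ((m : ℂ) + 1)⁻¹ ^ b *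
      ((-1) ^ a * coeff a (esymmSeries (Finset.range m) fun j => ((j : ℂ) + 1)⁻¹)))
      (zetaMinus (onesThen a b)) := by
  have h := (incTupleEquiv a).hasSum_iff.2 (summable_mplTerm_onesThen a hb).hasSum
  refine h.sigma fun m => ?_
  have hsign : (-1 : ℂ) ^ a * (-1) ^ a = 1 := pow_mul_pow_eq_one a (by simp)
  rw [coeff_esymmSeries, ← mul_assoc ((-1) ^ a), hsign, one_mul, Finset.mul_sum,
    ← Finset.sum_coe_sort (Finset.powersetCard a (Finset.range m))]
  simp only [Function.comp_apply, mplTerm_incTupleEquiv]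
  exact hasSum_fintype _

end Tuples

section Pairing

/-- The pairing of `f = ∑ fₗ Xˡ` with the values `ζ₋({1}ʳ⁻ˡ, w + l)`, twisted by the powers of `c`:
`∑ l ≤ r, cʳ⁻ˡ fₗ ζ₋({1}ʳ⁻ˡ, w + l)`. -/
noncomputable def zetaPairing (c : ℂ) (r w : ℕ) : ℂ⟦X⟧ →ₗ[ℂ] ℂ :=
  ∑ l ∈ Finset.range (r + 1), (c ^ (r - l) * zetaMinus (onesThen (r - l) (w + l))) • coeff l

theorem zetaPairing_apply (c : ℂ) (r w : ℕ) (f : ℂ⟦X⟧) :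
    zetaPairing c r w f = ∑ l ∈ Finset.range (r + 1),
      c ^ (r - l) * coeff l f * zetaMinus (onesThen (r - l) (w + l)) := by
  simp only [zetaPairing, LinearMap.sum_apply, LinearMap.smul_apply, smul_eq_mul]
  exact Finset.sum_congr rfl fun l _ => by ring

theorem zetaPairing_rescale (c d : ℂ) (r w : ℕ) (f : ℂ⟦X⟧) :
    zetaPairing (c * d) r w (rescale d f) = d ^ r * zetaPairing c r w f := by
  rw [zetaPairing_apply, zetaPairing_apply, Finset.mul_sum]
  refine Finset.sum_congr rfl fun l hl => ?_
  have hd : d ^ r = d ^ (r - l) * d ^ l := by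
    rw [← pow_add, Nat.sub_add_cancel (Finset.mem_range_succ_iff.1 hl)]
  rw [coeff_rescale, mul_pow, hd]
  ring

theorem zetaPairing_X_pow_mul_of_lt (c : ℂ) {d r : ℕ} (h : r < d) (w : ℕ) (f : ℂ⟦X⟧) :
    zetaPairing c r w (X ^ d * f) = 0 := by
  rw [zetaPairing_apply]
  refine Finset.sum_eq_zero fun l hl => ?_
  have hl := Finset.mem_range_succ_iff.1 hl
  rw [coeff_X_pow_mul', if_neg (by omega), mul_zero, zero_mul]

theorem zetaPairing_add_X_pow_mul (c : ℂ) (d r w : ℕ) (f : ℂ⟦X⟧) :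
    zetaPairing c (d + r) w (X ^ d * f) = zetaPairing c r (w + d) f := by
  rw [zetaPairing_apply, zetaPairing_apply, add_assoc, Finset.sum_range_add,
    Finset.sum_eq_zero fun l hl => ?_, zero_add]
  · refine Finset.sum_congr rfl fun l _ => ?_
    rw [coeff_X_pow_mul', if_pos (by omega), Nat.add_sub_cancel_left, Nat.add_sub_add_left,
      add_assoc]
  · rw [coeff_X_pow_mul', if_neg (Finset.mem_range.1 hl).not_ge, mul_zero, zero_mul]

theorem hasSum_zetaPairing (r : ℕ) {w : ℕ} (hw : 2 ≤ w) (f : ℂ⟦X⟧) :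
    HasSum (fun m : ℕ => coeff r (C ((-1) ^ m * ((m : ℂ) + 1)⁻¹ ^ w) *
      (rescale ((m : ℂ) + 1)⁻¹ f * esymmSeries (Finset.range m) fun j => ((j : ℂ) + 1)⁻¹)))
      (zetaPairing (-1) r w f) := by
  rw [zetaPairing_apply]
  refine (hasSum_sum fun l _ => (hasSum_zetaMinus_onesThen (r - l)
    (hw.trans (Nat.le_add_right w l))).mul_left ((-1) ^ (r - l) * coeff l f)).congr_fun fun m => ?_
  have hsign (a : ℕ) : (-1 : ℂ) ^ a * (-1) ^ a = 1 := pow_mul_pow_eq_one a (by simp)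
  rw [coeff_C_mul, coeff_mul, Finset.Nat.sum_antidiagonal_eq_sum_range_succ_mk, Finset.mul_sum]
  refine Finset.sum_congr rfl fun l _ => ?_
  rw [coeff_rescale]
  linear_combination -((-1) ^ m * ((m : ℂ) + 1)⁻¹ ^ w * ((m : ℂ) + 1)⁻¹ ^ l * coeff l f *
    coeff (r - l) (esymmSeries (Finset.range m) fun j => ((j : ℂ) + 1)⁻¹)) * hsign (r - l)

theorem zetaPairing_two_sub_X_mul_geomSeries_pow_mem_zetaAlgebra {s : ℕ} (hs : 1 ≤ s) (r : ℕ) :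
    zetaPairing (-1) r (2 * s) ((2 - X) * geomSeries 1 ^ s) ∈ zetaAlgebra := by
  rw [← (hasSum_zetaPairing r (by omega) _).tsum_eq]
  simp only [← limitWeight_mul_inv_node_pow]
  exact tsum_coeff_limitWeight_mul_mem_zetaAlgebra hs r

end Pairing

section SecondSum

/-- The series interpolating between the two sums of the theorem: up to rescaling, `t = 0` gives the
series that is paired to the first sum, and `u = 0` the one that is paired to the second. -/
noncomputable def bridgeSeries (u t : ℕ) : ℂ⟦X⟧ :=
  2 * (1 - X) * (1 - C 2 * X) * geomSeries 2 ^ u * geomSeries 1 ^ (2 * t)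

theorem bridgeSeries_zero_right (s : ℕ) :
    bridgeSeries (s + 1) 0 = rescale 2 ((2 - X) * geomSeries 1 ^ s) := by
  have h := one_sub_C_mul_X_mul_geomSeries (2 : ℂ)
  simp only [bridgeSeries, map_mul, map_sub, map_pow, rescale_X, rescale_geomSeries, map_ofNat,
    mul_zero, pow_zero, mul_one] at h ⊢
  linear_combination 2 * (1 - X) * geomSeries 2 ^ s * h

theorem bridgeSeries_zero_left (s : ℕ) :
    bridgeSeries 0 (s + 1) = 2 * (geomSeries 1 ^ (2 * s) - X * geomSeries 1 ^ (2 * s + 1)) := by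
  simp only [bridgeSeries, map_ofNat, pow_zero, mul_one]
  linear_combination (2 * (1 - 2 * X) * geomSeries 1 ^ (2 * s + 1) +
    2 * geomSeries 1 ^ (2 * s)) * one_sub_X_mul_geomSeries_one (R := ℂ)

theorem bridgeSeries_succ_right (u t : ℕ) :
    bridgeSeries u (t + 1) = bridgeSeries (u + 1) t - X ^ 2 * bridgeSeries (u + 1) (t + 1) := by
  have hu := one_sub_C_mul_X_mul_geomSeries (2 : ℂ)
  have ht := one_sub_X_mul_geomSeries_one (R := ℂ)
  simp only [bridgeSeries, map_ofNat] at hu ⊢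
  -- The identity behind the recursion is `(1 - X) ^ 2 - X ^ 2 = 1 - 2 * X`.
  linear_combination (2 * (1 - X) * (1 - 2 * X)) *
    (geomSeries 2 ^ (u + 1) * geomSeries 1 ^ (2 * t) * ((1 - X) * geomSeries 1 + 1) * ht -
      geomSeries 2 ^ u * geomSeries 1 ^ (2 * t + 2) * hu)

theorem zetaPairing_bridgeSeries_mem_zetaAlgebra {r s u t : ℕ} (hs : 1 ≤ s) (h : u + t = s + 1) :
    zetaPairing (-2) r (2 * s) (bridgeSeries u t) ∈ zetaAlgebra := by
  induction r using Nat.strong_induction_on generalizing s u t with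
  | _ r ihr =>
  induction t generalizing u with
  | zero =>
    obtain rfl : u = s + 1 := h
    have hc : (-2 : ℂ) = -1 * 2 := by norm_num
    rw [bridgeSeries_zero_right, hc, zetaPairing_rescale]
    exact mul_mem (pow_mem (ofNat_mem _ 2) r)
      (zetaPairing_two_sub_X_mul_geomSeries_pow_mem_zetaAlgebra hs r)
  | succ t iht =>
    rw [bridgeSeries_succ_right, map_sub]
    refine sub_mem (iht (by omega)) ?_
    rcases lt_or_ge r 2 with hr | hr
    · rw [zetaPairing_X_pow_mul_of_lt _ hr]
      exact zero_mem _
    · obtain ⟨q, rfl⟩ := Nat.exists_eq_add_of_le hr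
      rw [zetaPairing_add_X_pow_mul, ← mul_add_one]
      exact ihr q (by omega) (by omega) (by omega)

end SecondSum

section Coefficients

variable {R : Type*} [CommRing R]

theorem coeff_two_sub_X_mul_geomSeries_one_pow {s : ℕ} (hs : 1 ≤ s) (i : ℕ) :
    coeff i ((2 - X) * geomSeries (1 : R) ^ s) =
      ((intBinom ((s : ℤ) - 2 + i) i + intBinom ((s : ℤ) - 1 + i) i : ℤ) : R) := by
  obtain ⟨t, rfl⟩ := Nat.exists_eq_add_of_le' hs
  have hsplit : (2 - X) * geomSeries (1 : R) ^ (t + 1) =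
      geomSeries 1 ^ t + geomSeries 1 ^ (t + 1) := by
    linear_combination geomSeries 1 ^ t * one_sub_X_mul_geomSeries_one (R := R)
  have hindex : ((t + 1 : ℕ) : ℤ) - 2 = t - 1 := by push_cast; ring
  rw [hsplit, map_add, coeff_geomSeries_pow, coeff_geomSeries_pow, hindex]
  simp

theorem coeff_geomSeries_one_pow_sub_X_mul (s i : ℕ) :
    coeff i (geomSeries (1 : R) ^ s - X * geomSeries 1 ^ (s + 1)) =
      ((intBinom ((s : ℤ) + i - 1) i - intBinom ((s : ℤ) + i - 1) ((i : ℤ) - 1) : ℤ) : R) := by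
  rw [map_sub, coeff_geomSeries_pow]
  rcases i with _ | i
  · simp [intBinom]
  · rw [coeff_succ_X_mul, coeff_geomSeries_pow]
    push_cast
    ring_nf

end Coefficients

theorem theorem1 (r s : ℕ) (hs : 1 ≤ s) :
    (∀ i ∈ Finset.range (r + 1), Summable (mplTerm (-1) (onesThen (r - i) (2 * s + i)))) ∧
    IsRatPolyInZetaValues
      (∑ i ∈ Finset.range (r + 1),
        (-1 : ℂ) ^ (r - i) *
          ((intBinom ((s : ℤ) - 2 + i) i + intBinom ((s : ℤ) - 1 + i) i : ℤ) : ℂ) *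
          zetaMinus (onesThen (r - i) (2 * s + i))) ∧
    IsRatPolyInZetaValues
      (∑ i ∈ Finset.range (r + 1),
        (-1 : ℂ) ^ (r - i) * 2 ^ (r - i + 1) *
          ((intBinom (2 * (s : ℤ) + i - 1) i - intBinom (2 * (s : ℤ) + i - 1) ((i : ℤ) - 1) : ℤ) : ℂ) *
          zetaMinus (onesThen (r - i) (2 * s + i))) := by
  simp only [isRatPolyInZetaValues_iff_mem_zetaAlgebra]
  refine ⟨fun i _ => summable_mplTerm_onesThen _ (by omega), ?_, ?_⟩
  · have h := zetaPairing_two_sub_X_mul_geomSeries_pow_mem_zetaAlgebra hs r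
    simpa only [zetaPairing_apply, coeff_two_sub_X_mul_geomSeries_one_pow hs] using h
  · have h := zetaPairing_bridgeSeries_mem_zetaAlgebra (r := r) hs (zero_add (s + 1))
    rw [bridgeSeries_zero_left, zetaPairing_apply] at h
    convert! h using 1
    refine Finset.sum_congr rfl fun i _ => ?_
    have htwo : (2 : ℂ⟦X⟧) = C 2 := (map_ofNat C 2).symm
    rw [htwo, coeff_C_mul, coeff_geomSeries_one_pow_sub_X_mul, neg_pow 2, pow_succ]
    push_cast
    ring
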